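/- Consider a vector exponential family with densities (with respect to a $\sigma$-finite base measure, e.g. Lebesgue or counting measure) $f(x|\eta)=h(x)\exp(\eta^{T}\mathbf T(x)-A(\eta))$, with natural parameter $\eta$ in an open convex set $\Theta\subseteq\mathbb R^d$ on which the log partition function $A$ is finite, and write $D(\eta\|\eta')$ for the relative entropy of $f(\cdot|\eta)$ with respect to $f(\cdot|\eta')$. There are $K\ge 3$ arms. In configuration $\psi=(i,\eta_1,\eta_2)$, with $\eta_1\neq\eta_2$ in $\Theta$, observations of arm $i$ (the odd arm) have density $f(\cdot|\eta_1)$ and observations of every other arm have density $f(\cdot|\eta_2)$, independently over pulls. At each stage $n=1,2,\dots$ a policy $\pi$, given its past actions and observations, either stops and declares an arm $\delta$, or continues and pulls an arm $A_n$ drawn from a distribution of its choice. Let $\tau$ be the first stage at which it stops ($\tau=\infty$ if it never does), and let $$C(\pi)=\tau+\sum_{l=1}^{\tau-1}g(A_l,A_{l+1}),$$ where $g(a,a')\ge 0$ is the cost of switching from arm $a$ to arm $a'$, $g(a,a)=0$, and stopping itself involves no switch (the term $l=\tau-1$ is $0$). Let $\alpha=(\alpha_1,\dots,\alpha_K)\in(0,1)^K$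 with $\|\alpha\|:=\max_i\alpha_i\le\tfrac12$, and let $\Pi(\alpha)$ be the set of policies which, for every $i$ and every configuration $\psi=(i,\eta_1,\eta_2)$ with $\eta_1\ne\eta_2$, stop with a declaration $\delta\neq i$ with probability at most $\alpha_i$ under $\psi$. Then for every $\pi\in\Pi(\alpha)$ and every configuration $\psi=(i,\eta_1,\eta_2)$ with $\eta_1\neq\eta_2$, $$E[C(\pi)\,|\,\psi]\ \ge\ \frac{d_b(\|\alpha\|,1-\|\alpha\|)}{D^*(i,\eta_1,\eta_2)},$$ where $d_b(u,1-u)=u\log\frac{u}{1-u}+(1-u)\log\frac{1-u}{u}$ and $$D^*(i,\eta_1,\eta_2)=\sup_{\lambda}\ \inf_{\eta_1',\eta_2'\in\Theta,\ j\ne i}\bigl[\lambda(i)D(\eta_1\|\eta_2')+\lambda(j)D(\eta_2\|\eta_1')+(1-\lambda(i)-\lambda(j))D(\eta_2\|\eta_2')\bigr],$$ the supremum being over probability distributions $\lambda$ on the $K$ arms. (If $D^*=0$, the right-hand side is read as $+\infty$ when $d_b(\|\alpha\|,1-\|\alpha\|)>0$ and as $0$ when $\|\alpha\|=\tfrac12$.)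 -/

import Mathlib

open MeasureTheory ProbabilityTheory
open scoped ENNReal NNReal

namespace OddArm

/-- A vector exponential family on a measurable space `X`, with base measure `base`
(Lebesgue measure for densities, counting measure for mass functions), carrier function `h`,
sufficient statistic `T` and an open convex set `Θ ⊆ ℝ^d` of natural parameters. The last two
fields say that the log partition function is well defined and finite on `Θ`. -/
structure ExpFamily (X : Type*) [MeasurableSpace X] (d : ℕ) where
  base : Measure X
  sigmaFinite_base : SigmaFinite base
  h : X → ℝ
  measurable_h : Measurable h
  h_nonneg : ∀ x, 0 ≤ h x
  T : X → EuclideanSpace ℝ (Fin d)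
  measurable_T : Measurable T
  Θ : Set (EuclideanSpace ℝ (Fin d))
  isOpen_Θ : IsOpen Θ
  convex_Θ : Convex ℝ Θ
  integrable_exp : ∀ η ∈ Θ, Integrable (fun x => h x * Real.exp (inner ℝ η (T x))) base
  integral_pos : ∀ η ∈ Θ, 0 < ∫ x, h x * Real.exp (inner ℝ η (T x)) ∂base

namespace ExpFamily

variable {X : Type*} [MeasurableSpace X] {d : ℕ}

/-- The log partition function `A(η) = log ∫ h(x) exp(ηᵀ T(x)) dx`. -/
noncomputable def logPartition (F : ExpFamily X d) (η : EuclideanSpace ℝ (Fin d)) : ℝ :=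
  Real.log (∫ x, F.h x * Real.exp (inner ℝ η (F.T x)) ∂F.base)

/-- The density `f(x|η) = h(x) exp(ηᵀ T(x) - A(η))`. -/
noncomputable def density (F : ExpFamily X d) (η : EuclideanSpace ℝ (Fin d)) (x : X) : ℝ :=
  F.h x * Real.exp (inner ℝ η (F.T x) - F.logPartition η)

/-- The member `f(·|η)` of the family, as a measure on `X`. -/
noncomputable def law (F : ExpFamily X d) (η : F.Θ) : Measure X :=
  F.base.withDensity (fun x => ENNReal.ofReal (F.density η x))

instance isProbabilityMeasure_law (F : ExpFamily X d) (η : F.Θ) :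
    IsProbabilityMeasure (F.law η) := by
  have hpos := F.integral_pos η η.2
  have hint := F.integrable_exp η η.2
  have heq : F.density η = fun x => (F.h x * Real.exp (inner ℝ (η : EuclideanSpace ℝ (Fin d))
      (F.T x))) * (∫ x, F.h x * Real.exp (inner ℝ (η : EuclideanSpace ℝ (Fin d)) (F.T x))
        ∂F.base)⁻¹ := by
    funext x
    rw [density, logPartition, Real.exp_sub, Real.exp_log hpos]
    ring
  refine ⟨?_⟩
  rw [law, withDensity_apply _ MeasurableSet.univ, Measure.restrict_univ,
    ← ofReal_integral_eq_lintegral_ofReal]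
  · rw [heq, integral_mul_const, mul_inv_cancel₀ hpos.ne', ENNReal.ofReal_one]
  · rw [heq]
    exact hint.mul_const _
  · exact Filter.Eventually.of_forall fun x => mul_nonneg (F.h_nonneg x) (Real.exp_pos _).le

/-- The relative entropy `D(η‖η') = D(f(·|η) ‖ f(·|η'))`. -/
noncomputable def relEntropy (F : ExpFamily X d) (η η' : F.Θ) : ℝ≥0∞ :=
  InformationTheory.klDiv (F.law η) (F.law η')

/-- `D*(i, η₁, η₂)`: the max over distributions `w` on the arms of the min over `η₁'`, `η₂'` and
`j ≠ i` of `w(i) D(η₁‖η₂') + w(j) D(η₂‖η₁') + (1 - w(i) - w(j)) D(η₂‖η₂')`. -/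
noncomputable def complexity (F : ExpFamily X d) {K : ℕ} (i : Fin K) (η₁ η₂ : F.Θ) : ℝ≥0∞ :=
  ⨆ w ∈ stdSimplex ℝ (Fin K), ⨅ (η₁' : F.Θ) (η₂' : F.Θ) (j : Fin K) (_ : j ≠ i),
    (ENNReal.ofReal (w i) * F.relEntropy η₁ η₂' + ENNReal.ofReal (w j) * F.relEntropy η₂ η₁' +
      ENNReal.ofReal (1 - w i - w j) * F.relEntropy η₂ η₂')

end ExpFamily

/-- A configuration `ψ = (i, η₁, η₂)`: the odd arm, its parameter, and the (different) parameter
common to all other arms. -/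
structure Config {X : Type*} [MeasurableSpace X] {d : ℕ} (F : ExpFamily X d) (K : ℕ) where
  odd : Fin K
  η₁ : F.Θ
  η₂ : F.Θ
  ne : η₁ ≠ η₂

/-- The law of an observation of arm `a` under the configuration `ψ`. -/
noncomputable def Config.armLaw {X : Type*} [MeasurableSpace X] {d : ℕ} {F : ExpFamily X d}
    {K : ℕ} (ψ : Config F K) (a : Fin K) : Measure X :=
  if a = ψ.odd then F.law ψ.η₁ else F.law ψ.η₂

instance {X : Type*} [MeasurableSpace X] {d : ℕ} {F : ExpFamily X d} {K : ℕ}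
    (ψ : Config F K) (a : Fin K) : IsProbabilityMeasure (ψ.armLaw a) := by
  unfold Config.armLaw
  split_ifs <;> infer_instance

/-- What can be done at a stage: `Sum.inl δ` is "stop and declare `δ`",
`Sum.inr a` is "continue and pull arm `a`". -/
abbrev Action (K : ℕ) : Type := Fin K ⊕ Fin K

/-- What is recorded at a stage: `Sum.inl δ` is "stopped and declared `δ`",
`Sum.inr (a, x)` is "pulled arm `a` and observed `x`". -/
abbrev Outcome (K : ℕ) (X : Type*) : Type _ := Fin K ⊕ (Fin K × X)

/-- A (possibly randomised) policy: `act n` gives the law of the action at stage `n + 1` given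
the actions and observations of the first `n` stages. The values of `act n` at histories that
contain a stop action are irrelevant: all quantities below depend on the outcomes only up to
the first stop action. -/
structure Policy (K : ℕ) (X : Type*) [MeasurableSpace X] where
  act : (n : ℕ) → Kernel (Fin n → Outcome K X) (Action K)
  isMarkovKernel_act : ∀ n, IsMarkovKernel (act n)

section Sampling

variable {X : Type*} [MeasurableSpace X] {d : ℕ} {F : ExpFamily X d} {K : ℕ}

/-- The law of the outcome of an action: a pulled arm is observed, a stop is just recorded. -/
noncomputable def outcomeLaw (ψ : Config F K) : Action K → Measure (Outcome K X)
  | Sum.inl δ => Measure.dirac (Sum.inl δ)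
  | Sum.inr a => (ψ.armLaw a).map (fun x => Sum.inr (a, x))

/-- `outcomeLaw` as a kernel. -/
noncomputable def outcomeKernel (ψ : Config F K) : Kernel (Action K) (Outcome K X) where
  toFun := outcomeLaw ψ
  measurable' := measurable_fun_sum (measurable_of_countable _) (measurable_of_countable _)

theorem measurable_inr_mk (a : Fin K) :
    Measurable (fun x : X => (Sum.inr (a, x) : Outcome K X)) :=
  measurable_inr.comp measurable_prodMk_left

instance (ψ : Config F K) : IsMarkovKernel (outcomeKernel ψ) := by
  refine ⟨fun u => ?_⟩
  cases u with
  | inl δ => exact Measure.dirac.isProbabilityMeasure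
  | inr a => exact Measure.isProbabilityMeasure_map (measurable_inr_mk a).aemeasurable

/-- The law of the outcome of stage `n + 1` given the outcomes of the first `n` stages. -/
noncomputable def stageKernel (ψ : Config F K) (π : Policy K X) (n : ℕ) :
    Kernel (Fin n → Outcome K X) (Outcome K X) :=
  outcomeKernel ψ ∘ₖ π.act n

instance (ψ : Config F K) (π : Policy K X) (n : ℕ) : IsMarkovKernel (stageKernel ψ π n) := by
  have := π.isMarkovKernel_act n
  unfold stageKernel
  infer_instance

/-- Reindexing of a history of the stages `1, …, n + 1`, stored at the indices `0, …, n`. -/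
def toHistory (n : ℕ) (w : (k : Finset.Iic n) → Outcome K X) : Fin (n + 1) → Outcome K X :=
  fun k => w ⟨k, Finset.mem_Iic.2 (Nat.lt_succ_iff.1 k.2)⟩

theorem measurable_toHistory (n : ℕ) : Measurable (toHistory (K := K) (X := X) n) :=
  measurable_pi_lambda _ fun _ => measurable_pi_apply _

/-- The law of the sequence of outcomes (the outcome of stage `n + 1` has index `n`) when the
policy `π` is used under the configuration `ψ`. -/
noncomputable def processLaw (ψ : Config F K) (π : Policy K X) :
    Measure (ℕ → Outcome K X) :=
  Kernel.trajMeasure (X := fun _ => Outcome K X) (stageKernel ψ π 0 Fin.elim0)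
    (fun n => (stageKernel ψ π (n + 1)).comap (toHistory n) (measurable_toHistory n))

end Sampling

section Costs

variable {X : Type*} {K : ℕ}

/-- The stopping time `τ = inf {n ≥ 1 : the action at stage n is a stop}`. -/
noncomputable def stopTime (ω : ℕ → Outcome K X) : ℕ∞ :=
  ⨅ (n : ℕ) (_ : (ω n).isLeft), ((n + 1 : ℕ) : ℕ∞)

/-- The event that the procedure stops with the declaration `δ`. -/
def declares (δ : Fin K) : Set (ℕ → Outcome K X) :=
  {ω | ∃ n, (∀ m < n, (ω m).isRight) ∧ ω n = Sum.inl δ}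

/-- The event `δ ≠ i`: the procedure stops with a declaration other than `i`. -/
def falseDetection (i : Fin K) : Set (ℕ → Outcome K X) :=
  ⋃ (δ : Fin K) (_ : δ ≠ i), declares δ

/-- The cost of passing from one stage to the next: `g a a'` between pulls of arms `a` and `a'`.
Stopping pulls no arm, so it involves no switch. -/
def switchCost (g : Fin K → Fin K → ℝ≥0) : Outcome K X → Outcome K X → ℝ≥0
  | Sum.inr (a, _), Sum.inr (a', _) => g a a'
  | _, _ => 0

/-- The total cost `C = τ + ∑_{l=1}^{τ-1} g(A_l, A_{l+1})` (infinite if `τ` is).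
The summation index here is `l - 1`. -/
noncomputable def totalCost (g : Fin K → Fin K → ℝ≥0) (ω : ℕ → Outcome K X) : ℝ≥0∞ :=
  (stopTime ω : ℝ≥0∞) +
    ∑' m : ℕ, if ((m + 2 : ℕ) : ℕ∞) ≤ stopTime ω then
      (switchCost g (ω m) (ω (m + 1)) : ℝ≥0∞) else 0

end Costs

/-- `Π(α)`: the policies whose probability of false detection is at most `α i` under every
configuration with odd arm `i`. -/
def admissible {X : Type*} [MeasurableSpace X] {d : ℕ} (F : ExpFamily X d) {K : ℕ}
    (α : Fin K → ℝ) : Set (Policy K X) :=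
  {π | ∀ ψ : Config F K,
    processLaw ψ π (falseDetection ψ.odd) ≤ ENNReal.ofReal (α ψ.odd)}

/-- The expected total cost `E[C(π) | ψ]`. -/
noncomputable def expectedCost {X : Type*} [MeasurableSpace X] {d : ℕ} {F : ExpFamily X d}
    {K : ℕ} (g : Fin K → Fin K → ℝ≥0) (π : Policy K X) (ψ : Config F K) : ℝ≥0∞ :=
  ∫⁻ ω, totalCost g ω ∂(processLaw ψ π)

/-- The binary relative entropy `d_b(u, 1 - u)`. -/
noncomputable def binRelEntropy (u : ℝ) : ℝ :=
  u * Real.log (u / (1 - u)) + (1 - u) * Real.log ((1 - u) / u)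

end OddArm

/-! The proof is a transportation argument. Let `a = ‖α‖` and `L = log ((1 - a) / a)`, and compare
`ψ` (odd arm `i`) with any `ψ'` having another odd arm. Declaring `i` within `n` stages has
probability at most `a` under `ψ'`, whereas under `ψ` it has probability at least `1 - a - P(τ >
n)`.

The policy's own randomisation is common to both laws, so the likelihood ratio of the stopped
history involves only the observations (`lintegral_stoppedLogRatio`). Gibbs' inequality, tested on
that declaration, bounds the mean log-likelihood ratio from below by nearly `(1 - 2a) L = d_b(a, 1 -
a)` (`mul_log_le_integral_stoppedLogRatio`). A stagewise Wald identity bounds it from above by the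
expected pulls of each arm times its relative entropy (`ofReal_integral_stoppedLogRatio_le`).
Letting `n → ∞`, with `E τ < ∞`, gives `binRelEntropy_le_sum_expectedPulls`; the case `E τ = ∞` is
trivial.

Dividing by the expected total number `N` of pulls turns expected pulls into a point of the simplex.
The bound holds against every alternative, so `d_b / N ≤ D*`, while `N ≤ E τ ≤ E C`. The infimum in
`D*` also runs over `η₁' = η₂'`, which is no configuration; these points are handled by
approximation in `le_infoRate_of_forall_ne`. -/

namespace OddArm

/-! ### Likelihood ratios and relative entropy in the exponential family -/

namespace ExpFamily

variable {X : Type*} [MeasurableSpace X] {d : ℕ}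

/-- The log-likelihood ratio `log (f(x|η) / f(x|η'))`. -/
noncomputable def logRatio (F : ExpFamily X d) (η η' : F.Θ) (x : X) : ℝ :=
  inner ℝ (η - η' : EuclideanSpace ℝ (Fin d)) (F.T x) - F.logPartition η + F.logPartition η'

theorem logRatio_swap (F : ExpFamily X d) (η η' : F.Θ) (x : X) :
    F.logRatio η' η x = -F.logRatio η η' x := by
  simp only [logRatio, inner_sub_left]
  ring

theorem measurable_inner_T (F : ExpFamily X d) (v : EuclideanSpace ℝ (Fin d)) :
    Measurable fun x => inner ℝ v (F.T x) :=
  (continuous_const.inner continuous_id).measurable.comp F.measurable_T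

theorem measurable_logRatio (F : ExpFamily X d) (η η' : F.Θ) : Measurable (F.logRatio η η') :=
  ((F.measurable_inner_T _).sub_const _).add_const _

theorem measurable_exp_neg_logRatio (F : ExpFamily X d) (η η' : F.Θ) :
    Measurable fun x => Real.exp (-F.logRatio η η' x) :=
  (F.measurable_logRatio η η').neg.exp

theorem measurable_density (F : ExpFamily X d) (η : EuclideanSpace ℝ (Fin d)) :
    Measurable (F.density η) :=
  F.measurable_h.mul (Real.measurable_exp.comp ((F.measurable_inner_T _).sub_const _))

theorem density_mul_exp (F : ExpFamily X d) (η η' : F.Θ) (x : X) :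
    F.density η x * Real.exp (-F.logRatio η η' x) = F.density η' x := by
  simp only [density, logRatio, inner_sub_left]
  rw [mul_assoc, ← Real.exp_add]
  congr 2
  ring

theorem density_nonneg (F : ExpFamily X d) (η : EuclideanSpace ℝ (Fin d)) (x : X) :
    0 ≤ F.density η x :=
  mul_nonneg (F.h_nonneg x) (Real.exp_pos _).le

theorem law_withDensity (F : ExpFamily X d) (η η' : F.Θ) :
    (F.law η).withDensity (fun x => ENNReal.ofReal (Real.exp (-F.logRatio η η' x))) =
      F.law η' := by
  rw [law, ← withDensity_mul _ (F.measurable_density η).ennreal_ofReal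
    (F.measurable_exp_neg_logRatio η η').ennreal_ofReal, law]
  congr 1
  funext x
  rw [Pi.mul_apply, ← ENNReal.ofReal_mul (F.density_nonneg _ _), density_mul_exp]

theorem law_absolutelyContinuous (F : ExpFamily X d) (η η' : F.Θ) : F.law η' ≪ F.law η := by
  rw [← F.law_withDensity η η']
  exact withDensity_absolutelyContinuous _ _

theorem integrable_exp_neg_logRatio (F : ExpFamily X d) (η η' : F.Θ) :
    Integrable (fun x => Real.exp (-F.logRatio η η' x)) (F.law η) := by
  refine ⟨(F.measurable_exp_neg_logRatio η η').aestronglyMeasurable, ?_⟩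
  rw [hasFiniteIntegral_iff_ofReal (Filter.Eventually.of_forall fun x => (Real.exp_pos _).le),
    ← setLIntegral_univ, ← withDensity_apply _ MeasurableSet.univ, F.law_withDensity η η']
  exact measure_lt_top _ _

theorem integral_exp_neg_logRatio (F : ExpFamily X d) (η η' : F.Θ) :
    ∫ x, Real.exp (-F.logRatio η η' x) ∂F.law η = 1 := by
  rw [integral_eq_lintegral_of_nonneg_ae
      (Filter.Eventually.of_forall fun x => (Real.exp_pos _).le)
      (F.measurable_exp_neg_logRatio η η').aestronglyMeasurable,
    ← setLIntegral_univ, ← withDensity_apply _ MeasurableSet.univ, F.law_withDensity η η',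
    measure_univ, ENNReal.toReal_one]

/-- Exponential tilting by `t⟨v, T⟩` moves `η` to `η + t v` up to normalisation. Hence the moment
generating function of `⟨v, T⟩` is finite wherever `η + t v` stays in `Θ`. -/
theorem exp_mul_inner_eq (F : ExpFamily X d) (η η' : F.Θ) (v : EuclideanSpace ℝ (Fin d)) (t : ℝ)
    (h : (η' : EuclideanSpace ℝ (Fin d)) = η + t • v) (x : X) :
    Real.exp (t * inner ℝ v (F.T x)) = Real.exp (F.logPartition η' - F.logPartition η) *
      Real.exp (-F.logRatio η η' x) := by
  rw [← Real.exp_add]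
  congr 1
  have : (η - η' : EuclideanSpace ℝ (Fin d)) = -(t • v) := by rw [h]; abel
  rw [logRatio, this, inner_neg_left, real_inner_smul_left]
  ring

theorem mem_integrableExpSet_inner (F : ExpFamily X d) (η η' : F.Θ)
    (v : EuclideanSpace ℝ (Fin d)) (t : ℝ)
    (h : (η' : EuclideanSpace ℝ (Fin d)) = η + t • v) :
    t ∈ integrableExpSet (fun x => inner ℝ v (F.T x)) (F.law η) := by
  rw [integrableExpSet, Set.mem_ofPred_eq]
  simp_rw [F.exp_mul_inner_eq η η' v t h]
  exact (F.integrable_exp_neg_logRatio η η').const_mul _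

theorem cgf_inner (F : ExpFamily X d) (η η' : F.Θ) (v : EuclideanSpace ℝ (Fin d)) (t : ℝ)
    (h : (η' : EuclideanSpace ℝ (Fin d)) = η + t • v) :
    cgf (fun x => inner ℝ v (F.T x)) (F.law η) t = F.logPartition η' - F.logPartition η := by
  rw [cgf, mgf]
  simp_rw [F.exp_mul_inner_eq η η' v t h]
  rw [integral_const_mul, F.integral_exp_neg_logRatio, mul_one, Real.log_exp]

theorem eventually_add_smul_mem (F : ExpFamily X d) (η : F.Θ) (v : EuclideanSpace ℝ (Fin d)) :
    ∀ᶠ t : ℝ in nhds 0, (η + t • v : EuclideanSpace ℝ (Fin d)) ∈ F.Θ := by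
  have hc : Continuous fun t : ℝ => (η + t • v : EuclideanSpace ℝ (Fin d)) := by fun_prop
  exact hc.continuousAt.eventually_mem (F.isOpen_Θ.mem_nhds (by simp))

/-- Openness of `Θ` enters here; it yields integrability of `⟨v, T⟩` and analyticity of its cumulant
generating function at `0`. -/
theorem zero_mem_interior_integrableExpSet (F : ExpFamily X d) (η : F.Θ)
    (v : EuclideanSpace ℝ (Fin d)) :
    0 ∈ interior (integrableExpSet (fun x => inner ℝ v (F.T x)) (F.law η)) := by
  rw [mem_interior_iff_mem_nhds]
  filter_upwards [F.eventually_add_smul_mem η v] with t ht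
  exact F.mem_integrableExpSet_inner η ⟨_, ht⟩ v t rfl

theorem integrable_inner_T (F : ExpFamily X d) (η : F.Θ) (v : EuclideanSpace ℝ (Fin d)) :
    Integrable (fun x => inner ℝ v (F.T x)) (F.law η) :=
  integrable_of_mem_interior_integrableExpSet (F.zero_mem_interior_integrableExpSet η v)

theorem integrable_logRatio (F : ExpFamily X d) (η η' : F.Θ) :
    Integrable (F.logRatio η η') (F.law η) :=
  ((F.integrable_inner_T η _).sub (integrable_const _)).add (integrable_const _)

theorem llr_law (F : ExpFamily X d) (η η' : F.Θ) :
    llr (F.law η) (F.law η') =ᵐ[F.law η] F.logRatio η η' := by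
  have h := Measure.rnDeriv_withDensity (F.law η')
    (F.measurable_exp_neg_logRatio η' η).ennreal_ofReal
  rw [F.law_withDensity η' η] at h
  filter_upwards [(F.law_absolutelyContinuous η' η).ae_le h] with x hx
  rw [llr, hx, ENNReal.toReal_ofReal (Real.exp_pos _).le, Real.log_exp, logRatio_swap, neg_neg]

theorem relEntropy_eq (F : ExpFamily X d) (η η' : F.Θ) :
    F.relEntropy η η' = ENNReal.ofReal (∫ x, F.logRatio η η' x ∂F.law η) := by
  rw [relEntropy, InformationTheory.klDiv_of_ac_of_integrable (F.law_absolutelyContinuous η' η)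
    ((F.integrable_logRatio η η').congr (F.llr_law η η').symm), integral_congr_ae (F.llr_law η η')]
  simp

theorem relEntropy_self (F : ExpFamily X d) (η : F.Θ) : F.relEntropy η η = 0 :=
  InformationTheory.klDiv_self _

/-- Along a line through `η`, the relative entropy from `η` vanishes in the limit. -/
theorem exists_relEntropy_lt (F : ExpFamily X d) (η : F.Θ) {v : EuclideanSpace ℝ (Fin d)}
    (hv : v ≠ 0) {ε : ℝ≥0∞} (hε : 0 < ε) :
    ∃ η' : F.Θ, η' ≠ η ∧ F.relEntropy η η' < ε := by
  set Y : X → ℝ := fun x => inner ℝ v (F.T x) with hY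
  -- The expression inside is `D(η‖η + t v)`, written through the cumulant generating function,
  -- which is continuous at `0`.
  have hlim : Filter.Tendsto (fun t : ℝ => ENNReal.ofReal
      (-(t * ∫ x, Y x ∂F.law η) + cgf Y (F.law η) t)) (nhds 0) (nhds 0) := by
    have h1 : ContinuousAt (cgf Y (F.law η)) 0 :=
      (analyticAt_cgf (F.zero_mem_interior_integrableExpSet η v)).continuousAt
    have h2 : ContinuousAt (fun t : ℝ => ENNReal.ofReal
      (-(t * ∫ x, Y x ∂F.law η) + cgf Y (F.law η) t)) 0 :=
      ENNReal.continuous_ofReal.continuousAt.comp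
        ((by fun_prop : ContinuousAt (fun t : ℝ => -(t * ∫ x, Y x ∂F.law η)) 0).add h1)
    simpa using h2.tendsto
  have hev := (hlim.eventually (gt_mem_nhds hε)).and (F.eventually_add_smul_mem η v)
  obtain ⟨t, ⟨ht1, ht2⟩, ht0⟩ :=
    ((hev.filter_mono nhdsWithin_le_nhds).and (self_mem_nhdsWithin (s := {(0 : ℝ)}ᶜ))).exists
  refine ⟨⟨_, ht2⟩, fun h => ?_, ?_⟩
  · have := congrArg Subtype.val h
    simp only [add_eq_left, smul_eq_zero, hv, or_false] at this
    exact ht0 this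
  · rw [relEntropy_eq]
    convert ht1 using 2
    rw [F.cgf_inner η ⟨_, ht2⟩ v t rfl, ← integral_const_mul, ← integral_neg]
    have hl : F.logRatio η ⟨_, ht2⟩ = fun x => -(t * Y x) +
        (F.logPartition (η + t • v) - F.logPartition η) := by
      funext x
      simp only [logRatio, hY, sub_add_cancel_left, inner_neg_left, real_inner_smul_left]
      ring
    have hi : Integrable (fun x => -(t * Y x)) (F.law η) :=
      ((F.integrable_inner_T η v).const_mul t).neg
    rw [hl, integral_add hi (integrable_const _)]
    simp

end ExpFamily

/-! ### One-step disintegration and change of measure -/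

section Trajectory

variable {X : Type*} [MeasurableSpace X] {d : ℕ} {F : ExpFamily X d} {K : ℕ}

instance (ψ : Config F K) (π : Policy K X) : IsProbabilityMeasure (processLaw ψ π) := by
  unfold processLaw
  infer_instance

theorem map_eval_zero_processLaw (ψ : Config F K) (π : Policy K X) :
    (processLaw ψ π).map (fun ω => ω 0) = stageKernel ψ π 0 Fin.elim0 := by
  have h : (fun ω : ℕ → Outcome K X => ω 0) =
      (fun w : (k : Finset.Iic 0) → Outcome K X => w ⟨0, by simp⟩) ∘
        Preorder.frestrictLe (π := fun _ => Outcome K X) 0 := rfl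
  rw [h, ← Measure.map_map (by fun_prop) (by fun_prop), processLaw, Kernel.trajMeasure,
    Measure.map_comp _ _ (by fun_prop), Kernel.traj_map_frestrictLe, Kernel.partialTraj_self,
    Measure.id_comp, Measure.map_map (by fun_prop) (by fun_prop)]
  exact Measure.map_id

/-- Resampling the last relevant outcome from its conditional law given the past leaves the integral
unchanged. Index `0` is separate because the trajectory measure takes its initial law as separate
data. -/
theorem lintegral_processLaw_step (ψ : Config F K) (π : Policy K X) (n : ℕ)
    {G : (ℕ → Outcome K X) → ℝ≥0∞} (hG : Measurable G)
    (hdep : ∀ ω ω', (∀ k < n + 1, ω k = ω' k) → G ω = G ω') :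
    ∫⁻ ω, G ω ∂processLaw ψ π =
      ∫⁻ ω, ∫⁻ y, G (Function.update ω n y) ∂stageKernel ψ π n (fun k => ω k)
        ∂processLaw ψ π := by
  cases n with
  | zero =>
    have hm : Measurable fun y : Outcome K X => G fun _ => y := by fun_prop
    have h1 : ∀ ω, G ω = G fun _ => ω 0 := fun ω => hdep _ _ fun k hk => by
      obtain rfl : k = 0 := by omega
      rfl
    have h2 : ∀ ω y, G (Function.update ω 0 y) = G fun _ => y := fun ω y =>
      hdep _ _ fun k hk => by
        obtain rfl : k = 0 := by omega
        simp
    have h3 : ∀ ω : ℕ → Outcome K X, (fun k : Fin 0 => ω k) = Fin.elim0 := fun ω =>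
      funext fun k => k.elim0
    simp_rw [h2, h3, lintegral_const, measure_univ, mul_one]
    rw [← map_eval_zero_processLaw ψ π, lintegral_map hm (by fun_prop)]
    exact lintegral_congr h1
  | succ m =>
    let e : ((k : Finset.Iic m) → Outcome K X) × Outcome K X → ℕ → Outcome K X := fun p k =>
      if hk : k ≤ m then p.1 ⟨k, Finset.mem_Iic.2 hk⟩ else p.2
    have he : Measurable e := by
      refine measurable_pi_lambda _ fun k => ?_
      by_cases hk : k ≤ m
      · simp only [e, hk, dite_true]
        fun_prop
      · simp only [e, hk, dite_false]
        fun_prop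
    have hGe : Measurable fun p => G (e p) := hG.comp he
    have h1 : ∀ ω, G ω = G (e (Preorder.frestrictLe m ω, ω (m + 1))) := fun ω =>
      hdep _ _ fun k hk => by
        by_cases h : k ≤ m
        · simp [e, h]
        · obtain rfl : k = m + 1 := by omega
          simp [e]
    have h2 : ∀ ω y, G (Function.update ω (m + 1) y) = G (e (Preorder.frestrictLe m ω, y)) :=
      fun ω y => hdep _ _ fun k hk => by
        by_cases h : k ≤ m
        · have : k ≠ m + 1 := by omega
          simp [e, h, this]
        · obtain rfl : k = m + 1 := by omega
          simp [e]
    have key := Kernel.map_frestrictLe_trajMeasure_compProd_eq_map_trajMeasure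
      (X := fun _ => Outcome K X) (μ₀ := stageKernel ψ π 0 Fin.elim0)
      (κ := fun n => (stageKernel ψ π (n + 1)).comap (toHistory n) (measurable_toHistory n))
      (a := m)
    change (processLaw ψ π).map _ ⊗ₘ _ = (processLaw ψ π).map _ at key
    calc ∫⁻ ω, G ω ∂processLaw ψ π
        = ∫⁻ ω, G (e (Preorder.frestrictLe m ω, ω (m + 1))) ∂processLaw ψ π :=
          lintegral_congr h1
      _ = ∫⁻ p, G (e p) ∂(processLaw ψ π).map (fun x => (Preorder.frestrictLe m x, x (m + 1))) :=
          (lintegral_map hGe (by fun_prop)).symm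
      _ = _ := by
          rw [← key, Measure.lintegral_compProd hGe, lintegral_map _ (by fun_prop)]
          · simp_rw [h2]
            rfl
          · exact hGe.lintegral_kernel_prod_right'

instance measurableSingletonClass_action : MeasurableSingletonClass (Action K) := by
  refine ⟨fun u => ?_⟩
  cases u with
  | inl δ =>
    rw [← Set.image_singleton]
    exact (measurableSet_singleton δ).inl_image
  | inr a =>
    rw [← Set.image_singleton]
    exact measurableSet_inr_image.2 (measurableSet_singleton a)

theorem lintegral_stageKernel (ψ : Config F K) (π : Policy K X) (n : ℕ)
    (h : Fin n → Outcome K X) {f : Outcome K X → ℝ≥0∞} (hf : Measurable f) :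
    ∫⁻ y, f y ∂stageKernel ψ π n h =
      ∑ u : Action K, (∫⁻ y, f y ∂outcomeLaw ψ u) * π.act n h {u} := by
  rw [stageKernel, Kernel.lintegral_comp _ _ _ hf, lintegral_fintype]
  rfl

/-- The parameter of arm `a`. -/
def Config.param (ψ : Config F K) (a : Fin K) : F.Θ := if a = ψ.odd then ψ.η₁ else ψ.η₂

theorem Config.armLaw_eq (ψ : Config F K) (a : Fin K) : ψ.armLaw a = F.law (ψ.param a) := by
  unfold Config.armLaw Config.param
  split_ifs <;> rfl

/-- The log-likelihood ratio of an outcome between two configurations. -/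
noncomputable def outcomeLogRatio (ψ ψ' : Config F K) : Outcome K X → ℝ
  | Sum.inl _ => 0
  | Sum.inr (a, x) => F.logRatio (ψ.param a) (ψ'.param a) x

theorem measurable_outcomeLogRatio (ψ ψ' : Config F K) : Measurable (outcomeLogRatio ψ ψ') :=
  measurable_fun_sum measurable_const
    (measurable_from_prod_countable_right fun _ => F.measurable_logRatio _ _)

theorem lintegral_outcomeLaw_ratio (ψ ψ' : Config F K) (u : Action K)
    {f : Outcome K X → ℝ≥0∞} (hf : Measurable f) :
    ∫⁻ y, ENNReal.ofReal (Real.exp (-outcomeLogRatio ψ ψ' y)) * f y ∂outcomeLaw ψ u =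
      ∫⁻ y, f y ∂outcomeLaw ψ' u := by
  have hm : Measurable fun y => ENNReal.ofReal (Real.exp (-outcomeLogRatio ψ ψ' y)) * f y :=
    (measurable_outcomeLogRatio ψ ψ').neg.exp.ennreal_ofReal.mul hf
  cases u with
  | inl δ =>
    simp only [outcomeLaw]
    rw [lintegral_dirac' _ hm, lintegral_dirac' _ hf]
    simp [outcomeLogRatio]
  | inr a =>
    have hfa : Measurable fun x : X => f (Sum.inr (a, x)) := hf.comp (measurable_inr_mk a)
    simp only [outcomeLaw]
    rw [lintegral_map hm (measurable_inr_mk a), lintegral_map hf (measurable_inr_mk a),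
      ψ.armLaw_eq, ψ'.armLaw_eq, ← F.law_withDensity (ψ.param a) (ψ'.param a),
      lintegral_withDensity_eq_lintegral_mul _
        (F.measurable_exp_neg_logRatio _ _).ennreal_ofReal hfa]
    rfl

/-- The weights `π.act` do not depend on the configuration, so they cancel from the likelihood
ratio. -/
theorem lintegral_stageKernel_ratio (ψ ψ' : Config F K) (π : Policy K X) (n : ℕ)
    (h : Fin n → Outcome K X) {f : Outcome K X → ℝ≥0∞} (hf : Measurable f) :
    ∫⁻ y, ENNReal.ofReal (Real.exp (-outcomeLogRatio ψ ψ' y)) * f y ∂stageKernel ψ π n h =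
      ∫⁻ y, f y ∂stageKernel ψ' π n h := by
  have hm : Measurable fun y => ENNReal.ofReal (Real.exp (-outcomeLogRatio ψ ψ' y)) * f y :=
    (measurable_outcomeLogRatio ψ ψ').neg.exp.ennreal_ofReal.mul hf
  rw [lintegral_stageKernel ψ π n h hm, lintegral_stageKernel ψ' π n h hf]
  simp_rw [lintegral_outcomeLaw_ratio ψ ψ' _ hf]

end Trajectory

/-! ### Events and functions determined by the history up to the first stop -/

section Stopping

variable {X : Type*} {K : ℕ}

/-- The event that the procedure has not stopped during the first `n` stages. -/
def running (n : ℕ) : Set (ℕ → Outcome K X) := {ω | ∀ m < n, (ω m).isRight}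

/-- A function of the outcomes of the first `n` stages, up to the first stopping action. -/
def StoppedAt {β : Type*} (n : ℕ) (G : (ℕ → Outcome K X) → β) : Prop :=
  ∀ ω ω', (∀ k < n, ω ∈ running k → ω k = ω' k) → G ω = G ω'

theorem running_congr {n : ℕ} {ω ω' : ℕ → Outcome K X} (h : ∀ k < n, ω k = ω' k) :
    ω ∈ running n ↔ ω' ∈ running n := by
  unfold running
  exact forall₂_congr fun m hm => by rw [h m hm]

theorem update_mem_running {n k : ℕ} (hk : k ≤ n) (ω : ℕ → Outcome K X) (y : Outcome K X) :
    Function.update ω n y ∈ running k ↔ ω ∈ running k :=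
  running_congr fun m hm => Function.update_of_ne (by omega) _ _

theorem running_anti {k n : ℕ} (hk : k ≤ n) :
    (running n : Set (ℕ → Outcome K X)) ⊆ running k :=
  fun _ h m hm => h m (by omega)

theorem StoppedAt.update_of_notMem {β : Type*} {n : ℕ} {G : (ℕ → Outcome K X) → β}
    (hG : StoppedAt (n + 1) G) {ω : ℕ → Outcome K X} (hω : ω ∉ running n) (y : Outcome K X) :
    G (Function.update ω n y) = G ω := by
  refine (hG _ _ fun k hk hr => ?_).symm
  have : k ≠ n := by
    rintro rfl
    exact hω hr
  rw [Function.update_of_ne this]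

theorem measurableSet_isRight [MeasurableSpace X] (m : ℕ) :
    MeasurableSet {ω : ℕ → Outcome K X | (ω m).isRight} := by
  have h : MeasurableSet {y : Outcome K X | y.isRight} := by
    have : {y : Outcome K X | y.isRight} = Set.range Sum.inr := by
      ext y
      cases y <;> simp
    rw [this]
    exact measurableSet_range_inr
  exact (measurable_pi_apply (X := fun _ : ℕ => Outcome K X) m) h

theorem measurableSet_running [MeasurableSpace X] (n : ℕ) :
    MeasurableSet (running n : Set (ℕ → Outcome K X)) := by
  have : (running n : Set (ℕ → Outcome K X)) =
      ⋂ (m : ℕ) (_ : m < n), {ω : ℕ → Outcome K X | (ω m).isRight} := by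
    ext ω
    simp [running]
  rw [this]
  exact MeasurableSet.iInter fun m => MeasurableSet.iInter fun _ => measurableSet_isRight m

/-- The event that the procedure declares `i` during the first `n` stages. -/
def declaredBefore (i : Fin K) (n : ℕ) : Set (ℕ → Outcome K X) :=
  {ω | ∃ k < n, ω ∈ running k ∧ ω k = Sum.inl i}

theorem measurableSet_declaredBefore [MeasurableSpace X] (i : Fin K) (n : ℕ) :
    MeasurableSet (declaredBefore i n : Set (ℕ → Outcome K X)) := by
  have : (declaredBefore i n : Set (ℕ → Outcome K X)) =
      ⋃ (k : ℕ) (_ : k < n), running k ∩ {ω | ω k = Sum.inl i} := by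
    ext ω
    simp only [declaredBefore, Set.mem_ofPred_eq, Set.mem_iUnion, Set.mem_inter_iff, exists_prop]
  rw [this]
  refine MeasurableSet.iUnion fun k => MeasurableSet.iUnion fun _ =>
    (measurableSet_running k).inter ?_
  have h : MeasurableSet {y : Outcome K X | y = Sum.inl i} := by
    have : {y : Outcome K X | y = Sum.inl i} = Sum.inl '' {i} := by
      ext y
      simp
    rw [this]
    exact (measurableSet_singleton i).inl_image
  exact (measurable_pi_apply (X := fun _ : ℕ => Outcome K X) k) h

theorem stoppedAt_mem_declaredBefore (i : Fin K) (n : ℕ) :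
    StoppedAt n fun ω : ℕ → Outcome K X => ω ∈ declaredBefore i n := by
  intro ω ω' h
  have hrun : ∀ k ≤ n, ω ∈ running k → ∀ m < k, ω m = ω' m := fun k hk hr m hm =>
    h m (by omega) (running_anti hm.le hr)
  refine propext ⟨?_, ?_⟩
  · rintro ⟨k, hk, hr, he⟩
    exact ⟨k, hk, (running_congr (hrun k hk.le hr)).1 hr, by rw [← h k hk hr, he]⟩
  · rintro ⟨k, hk, hr, he⟩
    -- Agreement is assumed only while `ω` runs, so running is carried over from `ω'` by induction.
    have : ∀ m ≤ k, ω ∈ running m := by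
      intro m
      induction m with
      | zero => exact fun _ l hl => absurd hl (by omega)
      | succ m ih =>
        intro hm l hl
        rcases Nat.lt_succ_iff_lt_or_eq.1 hl with hl | rfl
        · exact ih (by omega) l hl
        · rw [h l (by omega) (ih (by omega))]
          exact hr l (by omega)
    exact ⟨k, hk, this k le_rfl, by rw [h k hk (this k le_rfl), he]⟩

theorem declaredBefore_subset_falseDetection {i j : Fin K} (hij : i ≠ j) (n : ℕ) :
    (declaredBefore i n : Set (ℕ → Outcome K X)) ⊆ falseDetection j := by
  rintro ω ⟨k, -, hr, he⟩
  exact Set.mem_iUnion₂.2 ⟨i, hij, k, hr, he⟩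

/-- If a stop occurs within `n` stages, the first one declares either `i` or another arm. -/
theorem univ_subset_stopping (i : Fin K) (n : ℕ) :
    (Set.univ : Set (ℕ → Outcome K X)) ⊆
      declaredBefore i n ∪ (running n ∪ falseDetection i) := by
  classical
  intro ω _
  by_cases hr : ω ∈ running n
  · exact Or.inr (Or.inl hr)
  have hr' : ∃ m, m < n ∧ ¬ (ω m).isRight := by
    simpa [running] using hr
  have hs := Nat.find_spec hr'
  have hmin : ω ∈ running (Nat.find hr') := fun l hl => by
    have := Nat.find_min hr' hl
    by_contra h
    exact this ⟨hl.trans hs.1, h⟩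
  obtain ⟨δ, hδ⟩ : ∃ δ, ω (Nat.find hr') = Sum.inl δ := by
    have := hs.2
    cases h : ω (Nat.find hr') with
    | inl δ => exact ⟨δ, rfl⟩
    | inr p => exact absurd (by rw [h]; rfl) this
  by_cases hi : δ = i
  · exact Or.inl ⟨_, hs.1, hmin, hi ▸ hδ⟩
  · exact Or.inr (Or.inr (Set.mem_iUnion₂.2 ⟨δ, hi, _, hmin, hδ⟩))

/-- Tail-sum formula: `running n` is the event `τ > n`. -/
theorem tsum_running_le_stopTime (ω : ℕ → Outcome K X) :
    ∑' n, (running n).indicator (fun _ => (1 : ℝ≥0∞)) ω ≤ (stopTime ω : ℝ≥0∞) := by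
  classical
  by_cases h : ∃ n, (ω n).isLeft
  · have hfin : ∀ n ∉ Finset.range (Nat.find h + 1),
        (running n).indicator (fun _ => (1 : ℝ≥0∞)) ω = 0 := by
      intro n hn
      rw [Finset.mem_range, not_lt] at hn
      refine Set.indicator_of_notMem (fun hr => ?_) _
      have h1 := hr (Nat.find h) (by omega)
      have h2 := Nat.find_spec h
      cases hx : ω (Nat.find h) <;> simp_all
    rw [tsum_eq_sum hfin]
    calc ∑ n ∈ Finset.range (Nat.find h + 1), (running n).indicator (fun _ => (1 : ℝ≥0∞)) ω
        ≤ ∑ n ∈ Finset.range (Nat.find h + 1), (1 : ℝ≥0∞) :=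
          Finset.sum_le_sum fun n _ => Set.indicator_le_self' (by simp) _
      _ = (((Nat.find h + 1 : ℕ) : ℕ∞) : ℝ≥0∞) := by simp
      _ ≤ (stopTime ω : ℝ≥0∞) := by
          rw [ENat.toENNReal_le]
          refine le_iInf₂ fun n hn => ?_
          exact_mod_cast Nat.succ_le_succ (Nat.find_min' h hn)
  · have : stopTime ω = ⊤ := by
      rw [stopTime, iInf₂_eq_top]
      exact fun n hn => absurd ⟨n, hn⟩ h
    simp [this]

end Stopping

/-! ### The stopped log-likelihood ratio and its mean -/

section Likelihood

variable {X : Type*} [MeasurableSpace X] {d : ℕ} {F : ExpFamily X d} {K : ℕ}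

/-- The log-likelihood ratio of the outcomes of the first `n` stages, up to the first stopping
action. -/
noncomputable def stoppedLogRatio (ψ ψ' : Config F K) (n : ℕ) (ω : ℕ → Outcome K X) : ℝ :=
  ∑ k ∈ Finset.range n, (running k).indicator (fun ω => outcomeLogRatio ψ ψ' (ω k)) ω

theorem measurable_outcomeLogRatio_eval (ψ ψ' : Config F K) (k : ℕ) :
    Measurable fun ω : ℕ → Outcome K X => outcomeLogRatio ψ ψ' (ω k) :=
  (measurable_outcomeLogRatio ψ ψ').comp (measurable_pi_apply k)

theorem measurable_stoppedLogRatio (ψ ψ' : Config F K) (n : ℕ) :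
    Measurable (stoppedLogRatio (X := X) ψ ψ' n) := by
  unfold stoppedLogRatio
  exact Finset.measurable_sum _ fun k _ =>
    (measurable_outcomeLogRatio_eval ψ ψ' k).indicator (measurableSet_running k)

theorem stoppedLogRatio_congr (ψ ψ' : Config F K) {n : ℕ} {ω ω' : ℕ → Outcome K X}
    (h : ∀ k < n, ω k = ω' k) : stoppedLogRatio ψ ψ' n ω = stoppedLogRatio ψ ψ' n ω' := by
  classical
  refine Finset.sum_congr rfl fun k hk => ?_
  have hk' := Finset.mem_range.1 hk
  have hr : ω ∈ running k ↔ ω' ∈ running k := running_congr fun m hm => h m (by omega)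
  simp only [Set.indicator_apply, hr, h k hk']

theorem stoppedLogRatio_update (ψ ψ' : Config F K) (n : ℕ) (ω : ℕ → Outcome K X)
    (y : Outcome K X) :
    stoppedLogRatio ψ ψ' (n + 1) (Function.update ω n y) =
      stoppedLogRatio ψ ψ' n ω +
        (running n).indicator (fun _ => outcomeLogRatio ψ ψ' y) ω := by
  classical
  have h1 : stoppedLogRatio ψ ψ' n (Function.update ω n y) = stoppedLogRatio ψ ψ' n ω :=
    stoppedLogRatio_congr ψ ψ' fun k hk => Function.update_of_ne hk.ne _ _
  rw [stoppedLogRatio, Finset.sum_range_succ, ← stoppedLogRatio, h1]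
  simp only [Set.indicator_apply, update_mem_running le_rfl, Function.update_self]

/-- Change of measure up to the first stopping action. -/
theorem lintegral_stoppedLogRatio (ψ ψ' : Config F K) (π : Policy K X) (n : ℕ)
    {G : (ℕ → Outcome K X) → ℝ≥0∞} (hG : Measurable G) (hs : StoppedAt n G) :
    ∫⁻ ω, ENNReal.ofReal (Real.exp (-stoppedLogRatio ψ ψ' n ω)) * G ω ∂processLaw ψ π =
      ∫⁻ ω, G ω ∂processLaw ψ' π := by
  induction n generalizing G with
  | zero =>
    obtain ⟨ω₀⟩ : Nonempty (ℕ → Outcome K X) := (processLaw ψ π).nonempty_of_neZero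
    have : ∀ ω, G ω = G ω₀ := fun ω => hs _ _ fun k hk => absurd hk (by omega)
    simp [stoppedLogRatio, this]
  | succ n ih =>
    have hdep : ∀ ω ω' : ℕ → Outcome K X, (∀ k < n + 1, ω k = ω' k) → G ω = G ω' :=
      fun ω ω' h => hs _ _ fun k hk _ => h k hk
    have hup : Measurable fun p : (ℕ → Outcome K X) × Outcome K X =>
        G (Function.update p.1 n p.2) := hG.comp measurable_update'
    have hupω : ∀ ω : ℕ → Outcome K X, Measurable fun y => G (Function.update ω n y) :=
      fun ω => hup.comp measurable_prodMk_left
    -- Averaging out the last outcome under `ψ'` gives a function to which the induction hypothesis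
    -- applies.
    let G' : (ℕ → Outcome K X) → ℝ≥0∞ := fun ω =>
      ∫⁻ y, G (Function.update ω n y) ∂stageKernel ψ' π n (fun k => ω k)
    have hG' : Measurable G' :=
      Measurable.lintegral_kernel_prod_right (κ := (stageKernel ψ' π n).comap
        (fun (ω : ℕ → Outcome K X) (k : Fin n) => ω k) (by fun_prop)) hup
    -- After a stop the likelihood ratio no longer changes, though later outcomes may have different
    -- laws under `ψ` and `ψ'`. `G` must therefore ignore them, whence `StoppedAt`.
    have hfrozen : ∀ ω ∉ (running n : Set (ℕ → Outcome K X)), G' ω = G ω := fun ω hω => by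
      simp only [G', hs.update_of_notMem hω, lintegral_const, measure_univ, mul_one]
    have hs' : StoppedAt n G' := by
      intro ω ω' h
      by_cases hω : ω ∈ running n
      · have hag : ∀ k < n, ω k = ω' k := fun k hk => h k hk (running_anti hk.le hω)
        have hh : (fun k : Fin n => ω k) = fun k : Fin n => ω' k :=
          funext fun k => hag k k.2
        simp only [G', hh]
        refine lintegral_congr fun y => hdep _ _ fun k hk => ?_
        by_cases hkn : k = n
        · subst hkn
          simp
        · simp [hkn, hag k (by omega)]
      -- The assumed agreement includes the first stop of `ω`, so `ω'` stops there too.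
      · have hω' : ω' ∉ running n := fun hr => by
          obtain ⟨m, hm, hmr⟩ : ∃ m < n, ¬ (ω m).isRight := by simpa [running] using hω
          classical
          have hex : ∃ m, ¬ (ω m).isRight := ⟨m, hmr⟩
          have hlt : Nat.find hex < n := (Nat.find_min' hex hmr).trans_lt hm
          have : ω (Nat.find hex) = ω' (Nat.find hex) :=
            h _ hlt fun l hl => not_not.1 (Nat.find_min hex hl)
          exact Nat.find_spec hex (this ▸ hr _ hlt)
        rw [hfrozen ω hω, hfrozen ω' hω']
        refine hs _ _ fun k hk hr => ?_
        have : k ≠ n := by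
          rintro rfl
          exact hω hr
        exact h k (by omega) hr
    have hexp : Measurable fun ω : ℕ → Outcome K X =>
        ENNReal.ofReal (Real.exp (-stoppedLogRatio ψ ψ' (n + 1) ω)) * G ω :=
      (measurable_stoppedLogRatio ψ ψ' (n + 1)).neg.exp.ennreal_ofReal.mul hG
    rw [lintegral_processLaw_step ψ π n hexp fun ω ω' h => by
        simp only [stoppedLogRatio_congr ψ ψ' h, hdep ω ω' h],
      lintegral_processLaw_step ψ' π n hG hdep, ← ih hG' hs']
    refine lintegral_congr fun ω => ?_
    simp only [stoppedLogRatio_update]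
    by_cases hω : ω ∈ running n
    · simp only [Set.indicator_of_mem hω, neg_add, Real.exp_add,
        ENNReal.ofReal_mul (Real.exp_pos _).le, mul_assoc]
      rw [lintegral_const_mul' _ _ ENNReal.ofReal_ne_top,
        lintegral_stageKernel_ratio ψ ψ' π n _ (hupω ω)]
    · simp only [Set.indicator_of_notMem hω, add_zero, hs.update_of_notMem hω, lintegral_const,
        measure_univ, mul_one, hfrozen ω hω]

/-- The probability that stage `k + 1` is reached and its action is `u`. -/
noncomputable def actionProb (ψ : Config F K) (π : Policy K X) (k : ℕ) (u : Action K) : ℝ≥0∞ :=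
  ∫⁻ ω in running k, π.act k (fun m => ω m) {u} ∂processLaw ψ π

theorem measurable_act_apply (π : Policy K X) (k : ℕ) (u : Action K) :
    Measurable fun ω : ℕ → Outcome K X => π.act k (fun m => ω m) {u} :=
  ((π.act k).measurable_coe (measurableSet_singleton u)).comp
    (measurable_pi_lambda _ fun m => measurable_pi_apply (m : ℕ))

/-- Conditionally on the action, the outcome is independent of the past; this reduces means of
increments to finite mixtures. -/
theorem map_eval_restrict_running (ψ : Config F K) (π : Policy K X) (k : ℕ) :
    ((processLaw ψ π).restrict (running k)).map (fun ω => ω k) =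
      ∑ u : Action K, actionProb ψ π k u • outcomeLaw ψ u := by
  classical
  ext s hs
  have hsm : MeasurableSet ((fun ω : ℕ → Outcome K X => ω k) ⁻¹' s) := measurable_pi_apply k hs
  have hr := measurableSet_running (X := X) (K := K) k
  have hm := hsm.inter hr
  rw [Measure.map_apply (measurable_pi_apply k) hs, Measure.restrict_apply hsm,
    ← lintegral_indicator_one hm, lintegral_processLaw_step ψ π k (measurable_one.indicator hm)
      fun ω ω' h => by
        have h1 : ω ∈ running k ↔ ω' ∈ running k := running_congr fun m hm => h m (by omega)
        simp only [Set.indicator_apply, Set.mem_inter_iff, Set.mem_preimage, h k (by omega), h1,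
          Pi.one_apply]]
  have hinner : ∀ ω : ℕ → Outcome K X,
      ∫⁻ y, ((fun ω : ℕ → Outcome K X => ω k) ⁻¹' s ∩ running k).indicator 1
        (Function.update ω k y) ∂stageKernel ψ π k (fun m => ω m) =
      (running k).indicator
        (fun ω => ∑ u, outcomeLaw ψ u s * π.act k (fun m => ω m) {u}) ω := by
    intro ω
    by_cases hω : ω ∈ running k
    · rw [Set.indicator_of_mem hω]
      calc _ = ∫⁻ y, s.indicator 1 y ∂stageKernel ψ π k (fun m => ω m) :=
            lintegral_congr fun y => by
              simp [Set.indicator_apply, update_mem_running le_rfl, hω]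
        _ = _ := by
            rw [lintegral_stageKernel ψ π k _ (measurable_one.indicator hs)]
            simp_rw [lintegral_indicator_one hs]
    · rw [Set.indicator_of_notMem hω]
      simp [update_mem_running le_rfl, hω]
  simp_rw [hinner]
  rw [lintegral_indicator hr, lintegral_finsetSum _ fun u _ =>
    (measurable_act_apply π k u).const_mul _, Measure.finsetSum_apply]
  refine Finset.sum_congr rfl fun u _ => ?_
  rw [lintegral_const_mul _ (measurable_act_apply π k u), Measure.smul_apply, smul_eq_mul,
    mul_comm, actionProb]

theorem sum_actionProb (ψ : Config F K) (π : Policy K X) (k : ℕ) :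
    ∑ u, actionProb ψ π k u = processLaw ψ π (running k) := by
  have h := congrArg (fun μ => μ Set.univ) (map_eval_restrict_running ψ π k)
  have hp : ∀ u : Action K, outcomeLaw ψ u Set.univ = 1 := fun u =>
    measure_univ (μ := outcomeKernel ψ u)
  simp only [Measure.finsetSum_apply, Measure.smul_apply, hp, smul_eq_mul, mul_one] at h
  rw [← h, Measure.map_apply (measurable_pi_apply k) MeasurableSet.univ]
  simp

theorem actionProb_ne_top (ψ : Config F K) (π : Policy K X) (k : ℕ) (u : Action K) :
    actionProb ψ π k u ≠ ∞ := by
  refine ne_top_of_le_ne_top (measure_ne_top (processLaw ψ π) (running k)) ?_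
  rw [← sum_actionProb]
  exact Finset.single_le_sum (f := actionProb ψ π k) (fun _ _ => zero_le) (Finset.mem_univ u)

theorem integrable_outcomeLogRatio (ψ ψ' : Config F K) (u : Action K) :
    Integrable (outcomeLogRatio ψ ψ') (outcomeLaw ψ u) := by
  cases u with
  | inl δ => exact (integrable_dirac' (measurable_outcomeLogRatio ψ ψ').stronglyMeasurable (by
      simp))
  | inr a =>
    rw [outcomeLaw, integrable_map_measure (measurable_outcomeLogRatio ψ ψ').aestronglyMeasurable
      (measurable_inr_mk a).aemeasurable, ψ.armLaw_eq]
    exact F.integrable_logRatio _ _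

theorem integral_outcomeLogRatio_inl (ψ ψ' : Config F K) (δ : Fin K) :
    ∫ y, outcomeLogRatio ψ ψ' y ∂outcomeLaw (X := X) ψ (Sum.inl δ) = 0 := by
  rw [outcomeLaw, integral_dirac' _ _ (measurable_outcomeLogRatio ψ ψ').stronglyMeasurable]
  rfl

theorem integral_outcomeLogRatio_inr (ψ ψ' : Config F K) (a : Fin K) :
    ∫ y, outcomeLogRatio ψ ψ' y ∂outcomeLaw (X := X) ψ (Sum.inr a) =
      ∫ x, F.logRatio (ψ.param a) (ψ'.param a) x ∂F.law (ψ.param a) := by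
  rw [outcomeLaw, integral_map (measurable_inr_mk a).aemeasurable
    (measurable_outcomeLogRatio ψ ψ').aestronglyMeasurable, ψ.armLaw_eq]
  rfl

theorem integrable_running_outcomeLogRatio (ψ ψ' : Config F K) (π : Policy K X) (k : ℕ) :
    Integrable ((running k).indicator fun ω => outcomeLogRatio ψ ψ' (ω k))
      (processLaw ψ π) := by
  rw [integrable_indicator_iff (measurableSet_running k)]
  have h : Integrable (outcomeLogRatio ψ ψ')
      (((processLaw ψ π).restrict (running k)).map (fun ω => ω k)) := by
    rw [map_eval_restrict_running, integrable_finsetSum_measure]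
    exact fun u _ => (integrable_outcomeLogRatio ψ ψ' u).smul_measure (actionProb_ne_top ψ π k u)
  exact h.comp_measurable (measurable_pi_apply k)

/-- Wald's identity for a single stage; stop actions contribute zero. -/
theorem integral_running_outcomeLogRatio (ψ ψ' : Config F K) (π : Policy K X) (k : ℕ) :
    ∫ ω, (running k).indicator (fun ω => outcomeLogRatio ψ ψ' (ω k)) ω ∂processLaw ψ π =
      ∑ a, (actionProb ψ π k (Sum.inr a)).toReal *
        ∫ x, F.logRatio (ψ.param a) (ψ'.param a) x ∂F.law (ψ.param a) := by
  rw [integral_indicator (measurableSet_running k), ← integral_map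
    (f := outcomeLogRatio ψ ψ') (φ := fun ω : ℕ → Outcome K X => ω k)
    (measurable_pi_apply k).aemeasurable (measurable_outcomeLogRatio ψ ψ').aestronglyMeasurable,
    map_eval_restrict_running, integral_finsetSum_measure fun u _ =>
      (integrable_outcomeLogRatio ψ ψ' u).smul_measure (actionProb_ne_top ψ π k u)]
  simp [Fintype.sum_sum_type, integral_outcomeLogRatio_inl, integral_outcomeLogRatio_inr]

theorem integrable_stoppedLogRatio (ψ ψ' : Config F K) (π : Policy K X) (n : ℕ) :
    Integrable (stoppedLogRatio ψ ψ' n) (processLaw ψ π) :=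
  integrable_finsetSum _ fun k _ => integrable_running_outcomeLogRatio ψ ψ' π k

/-- The expected number of stages at which arm `a` is pulled before stopping. -/
noncomputable def expectedPulls (ψ : Config F K) (π : Policy K X) (a : Fin K) : ℝ≥0∞ :=
  ∑' k, actionProb ψ π k (Sum.inr a)

theorem ofReal_integral_stoppedLogRatio_le (ψ ψ' : Config F K) (π : Policy K X) (n : ℕ) :
    ENNReal.ofReal (∫ ω, stoppedLogRatio ψ ψ' n ω ∂processLaw ψ π) ≤
      ∑ a, expectedPulls ψ π a * F.relEntropy (ψ.param a) (ψ'.param a) := by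
  have hfin : ∀ a, F.relEntropy (ψ.param a) (ψ'.param a) ≠ ∞ := fun a => by
    rw [ExpFamily.relEntropy_eq]
    exact ENNReal.ofReal_ne_top
  have hne : ∀ k a, actionProb ψ π k (Sum.inr a) * F.relEntropy (ψ.param a) (ψ'.param a) ≠ ∞ :=
    fun k a => ENNReal.mul_ne_top (actionProb_ne_top ψ π k _) (hfin a)
  calc ENNReal.ofReal (∫ ω, stoppedLogRatio ψ ψ' n ω ∂processLaw ψ π)
      ≤ ∑ k ∈ Finset.range n, ∑ a, actionProb ψ π k (Sum.inr a) *
          F.relEntropy (ψ.param a) (ψ'.param a) := by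
        rw [← ENNReal.ofReal_toReal (ENNReal.sum_ne_top.2 fun k _ =>
          ENNReal.sum_ne_top.2 fun a _ => hne k a)]
        refine ENNReal.ofReal_le_ofReal ?_
        unfold stoppedLogRatio
        rw [integral_finsetSum _ fun k _ => integrable_running_outcomeLogRatio ψ ψ' π k,
          ENNReal.toReal_sum fun k _ => ENNReal.sum_ne_top.2 fun a _ => hne k a]
        refine Finset.sum_le_sum fun k _ => ?_
        rw [integral_running_outcomeLogRatio, ENNReal.toReal_sum fun a _ => hne k a]
        refine Finset.sum_le_sum fun a _ => ?_
        rw [ENNReal.toReal_mul, ExpFamily.relEntropy_eq]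
        -- Truncation at `0` only increases a real number, so nonnegativity of the mean is not
        -- needed.
        exact mul_le_mul_of_nonneg_left (ENNReal.toReal_ofReal' ▸ le_max_left _ _)
          ENNReal.toReal_nonneg
    _ = ∑ a, (∑ k ∈ Finset.range n, actionProb ψ π k (Sum.inr a)) *
          F.relEntropy (ψ.param a) (ψ'.param a) := by
        rw [Finset.sum_comm]
        simp_rw [Finset.sum_mul]
    _ ≤ _ := by
        gcongr
        exact ENNReal.sum_le_tsum _

/-- The slack is the final stage, which stops instead of pulling. -/
theorem sum_expectedPulls_le (ψ : Config F K) (π : Policy K X) :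
    ∑ a, expectedPulls ψ π a ≤ ∑' k, processLaw ψ π (running k) := by
  unfold expectedPulls
  rw [← Summable.tsum_finsetSum fun _ _ => ENNReal.summable]
  refine ENNReal.tsum_le_tsum fun k => ?_
  rw [← sum_actionProb, Fintype.sum_sum_type]
  exact le_add_self

theorem tsum_running_le_expectedCost (g : Fin K → Fin K → ℝ≥0) (ψ : Config F K)
    (π : Policy K X) : ∑' k, processLaw ψ π (running k) ≤ expectedCost g π ψ := by
  calc ∑' k, processLaw ψ π (running k)
      = ∫⁻ ω, ∑' k, (running k).indicator (fun _ => (1 : ℝ≥0∞)) ω ∂processLaw ψ π := by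
        rw [lintegral_tsum fun k =>
          (measurable_const.indicator (measurableSet_running k)).aemeasurable]
        refine tsum_congr fun k => ?_
        rw [lintegral_indicator_const (measurableSet_running k), one_mul]
    _ ≤ _ := lintegral_mono fun ω => (tsum_running_le_stopTime ω).trans le_self_add

end Likelihood

/-! ### The transportation inequality and degenerate alternatives -/

section LowerBound

variable {X : Type*} [MeasurableSpace X] {d : ℕ} {F : ExpFamily X d} {K : ℕ}

theorem binRelEntropy_eq (a : ℝ) :
    binRelEntropy a = (1 - 2 * a) * Real.log ((1 - a) / a) := by
  rw [binRelEntropy, ← inv_div, Real.log_inv]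
  ring

theorem integral_add_indicator {Ω : Type*} [MeasurableSpace Ω] (μ : Measure Ω)
    [IsProbabilityMeasure μ] {S : Set Ω} (hS : MeasurableSet S) (b c : ℝ) :
    ∫ ω, (b + S.indicator (fun _ => c) ω) ∂μ = b + μ.real S * c := by
  rw [integral_add (integrable_const _) ((integrable_const _).indicator hS),
    integral_indicator_const _ hS]
  simp

/-- Gibbs' variational inequality for the stopped likelihood ratio, tested on the event that `i`
is declared during the first `n` stages. -/
theorem mul_log_le_integral_stoppedLogRatio (ψ ψ' : Config F K) (π : Policy K X) (n : ℕ)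
    (i : Fin K) {a : ℝ} (ha : 0 < a) (ha' : a ≤ 1 / 2)
    (hq : (processLaw ψ' π).real (declaredBefore i n) ≤ a) :
    (2 * (processLaw ψ π).real (declaredBefore i n) - 1) * Real.log ((1 - a) / a) ≤
      ∫ ω, stoppedLogRatio ψ ψ' n ω ∂processLaw ψ π := by
  classical
  set P := processLaw ψ π
  set Q := processLaw ψ' π
  set S : Set (ℕ → Outcome K X) := declaredBefore i n
  have hS : MeasurableSet S := measurableSet_declaredBefore i n
  set L := Real.log ((1 - a) / a)
  have hexpL : Real.exp L = (1 - a) / a := Real.exp_log (div_pos (by linarith) ha)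
  have hexpL' : Real.exp (-L) = a / (1 - a) := by rw [Real.exp_neg, hexpL, inv_div]
  -- `f` is `L` on `S` and `-L` off it: the log-likelihood ratio of Bernoulli(`1 - a`) to
  -- Bernoulli(`a`), the optimal test function in Gibbs' inequality for that pair.
  set f : (ℕ → Outcome K X) → ℝ := fun ω => -L + S.indicator (fun _ => 2 * L) ω with hf
  have hfm : Measurable f := measurable_const.add (measurable_const.indicator hS)
  have hfi : Integrable f P := (integrable_const _).add ((integrable_const _).indicator hS)
  have hexpf : ∀ ω, Real.exp (f ω) =
      a / (1 - a) + S.indicator (fun _ => (1 - a) / a - a / (1 - a)) ω := by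
    intro ω
    by_cases hω : ω ∈ S
    · simp only [hf, Set.indicator_of_mem hω]
      rw [show -L + 2 * L = L by ring, hexpL]
      ring
    · simp only [hf, Set.indicator_of_notMem hω, add_zero, hexpL']
  have hexpi : Integrable (fun ω => Real.exp (f ω)) Q := by
    simp_rw [hexpf]
    exact (integrable_const _).add ((integrable_const _).indicator hS)
  -- The integral equals `1` when `Q(S) = a` and is nondecreasing in `Q(S)`, because `a ≤ 1/2`.
  have hJ : ∫ ω, Real.exp (f ω) ∂Q ≤ 1 := by
    simp_rw [hexpf]
    rw [integral_add_indicator Q hS]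
    have h1 : 0 ≤ (1 - a) / a - a / (1 - a) := by
      rw [sub_nonneg, div_le_div_iff₀ (by linarith) ha]
      nlinarith
    have h2 : a / (1 - a) + a * ((1 - a) / a - a / (1 - a)) = 1 := by
      have : 1 - a ≠ 0 := by linarith
      field_simp
      ring
    linarith [mul_le_mul_of_nonneg_right hq h1]
  have hZm := measurable_stoppedLogRatio (X := X) ψ ψ' n
  have hZi : Integrable (stoppedLogRatio ψ ψ' n) P := integrable_stoppedLogRatio ψ ψ' π n
  have hgm : Measurable fun ω => Real.exp (f ω - stoppedLogRatio ψ ψ' n ω) := (hfm.sub hZm).exp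
  have hfrozen : StoppedAt n fun ω => ENNReal.ofReal (Real.exp (f ω)) := fun ω ω' h => by
    have : (ω ∈ S) = (ω' ∈ S) := stoppedAt_mem_declaredBefore i n ω ω' h
    simp only [hf, Set.indicator_apply, this]
  have hchange : ∫⁻ ω, ENNReal.ofReal (Real.exp (f ω - stoppedLogRatio ψ ψ' n ω)) ∂P =
      ENNReal.ofReal (∫ ω, Real.exp (f ω) ∂Q) := by
    rw [ofReal_integral_eq_lintegral_ofReal hexpi
      (Filter.Eventually.of_forall fun ω => (Real.exp_pos _).le),
      ← lintegral_stoppedLogRatio ψ ψ' π n hfm.exp.ennreal_ofReal hfrozen]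
    refine lintegral_congr fun ω => ?_
    rw [← ENNReal.ofReal_mul (Real.exp_pos _).le, ← Real.exp_add, sub_eq_neg_add]
  have hgi : Integrable (fun ω => Real.exp (f ω - stoppedLogRatio ψ ψ' n ω)) P := by
    refine ⟨hgm.aestronglyMeasurable, ?_⟩
    rw [hasFiniteIntegral_iff_ofReal (Filter.Eventually.of_forall fun ω => (Real.exp_pos _).le),
      hchange]
    exact ENNReal.ofReal_lt_top
  have hg1 : ∫ ω, Real.exp (f ω - stoppedLogRatio ψ ψ' n ω) ∂P ≤ 1 := by
    rw [integral_eq_lintegral_of_nonneg_ae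
      (Filter.Eventually.of_forall fun ω => (Real.exp_pos _).le) hgm.aestronglyMeasurable, hchange,
      ENNReal.toReal_ofReal (integral_nonneg fun ω => (Real.exp_pos _).le)]
    exact hJ
  have hmono : ∫ ω, ((f ω - stoppedLogRatio ψ ψ' n ω) + 1) ∂P ≤
      ∫ ω, Real.exp (f ω - stoppedLogRatio ψ ψ' n ω) ∂P :=
    integral_mono ((hfi.sub hZi).add (integrable_const _)) hgi fun ω => Real.add_one_le_exp _
  have hfint : ∫ ω, f ω ∂P = -L + P.real S * (2 * L) := integral_add_indicator P hS _ _
  have hsub : ∫ ω, ((f ω - stoppedLogRatio ψ ψ' n ω) + 1) ∂P =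
      ∫ ω, f ω ∂P - ∫ ω, stoppedLogRatio ψ ψ' n ω ∂P + 1 := by
    have hi : Integrable (fun ω => f ω - stoppedLogRatio ψ ψ' n ω) P := hfi.sub hZi
    rw [integral_add hi (integrable_const _), integral_sub hfi hZi]
    simp
  linarith

/-- The transportation inequality: a policy that tells `ψ` from `ψ'` collects enough information,
provided its expected stopping time under `ψ` is finite. -/
theorem binRelEntropy_le_sum_expectedPulls (ψ ψ' : Config F K) (hne : ψ'.odd ≠ ψ.odd)
    (π : Policy K X) {a : ℝ} (ha : 0 < a) (ha' : a ≤ 1 / 2)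
    (hP : processLaw ψ π (falseDetection ψ.odd) ≤ ENNReal.ofReal a)
    (hQ : processLaw ψ' π (falseDetection ψ'.odd) ≤ ENNReal.ofReal a)
    (hτ : ∑' k, processLaw ψ π (running k) ≠ ∞) :
    ENNReal.ofReal (binRelEntropy a) ≤
      ∑ b, expectedPulls ψ π b * F.relEntropy (ψ.param b) (ψ'.param b) := by
  set L := Real.log ((1 - a) / a) with hL
  have hL0 : 0 ≤ L := Real.log_nonneg (by rw [le_div_iff₀ ha]; linarith)
  have hbound : ∀ n, ENNReal.ofReal (binRelEntropy a) ≤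
      (∑ b, expectedPulls ψ π b * F.relEntropy (ψ.param b) (ψ'.param b)) +
        ENNReal.ofReal (2 * L) * processLaw ψ π (running n) := by
    intro n
    have hq : (processLaw ψ' π).real (declaredBefore ψ.odd n) ≤ a :=
      ENNReal.toReal_le_of_le_ofReal ha.le
        ((measure_mono (declaredBefore_subset_falseDetection hne.symm n)).trans hQ)
    have hfd : (processLaw ψ π).real (falseDetection ψ.odd) ≤ a :=
      ENNReal.toReal_le_of_le_ofReal ha.le hP
    -- Inserted in the Gibbs bound, this gives `(2 P(S) - 1) L ≥ (1 - 2a) L - 2 L P(τ > n)`.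
    have hp : 1 ≤ (processLaw ψ π).real (declaredBefore ψ.odd n) +
        ((processLaw ψ π).real (running n) + a) := by
      calc 1 = (processLaw ψ π).real Set.univ := by simp
        _ ≤ (processLaw ψ π).real
              (declaredBefore ψ.odd n ∪ (running n ∪ falseDetection ψ.odd)) :=
            measureReal_mono (univ_subset_stopping ψ.odd n)
        _ ≤ _ := (measureReal_union_le _ _).trans
            (add_le_add_right ((measureReal_union_le _ _).trans (add_le_add_right hfd _)) _)
    have hZ := mul_log_le_integral_stoppedLogRatio ψ ψ' π n ψ.odd ha ha' hq
    have hr : ENNReal.ofReal (2 * L) * processLaw ψ π (running n) =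
        ENNReal.ofReal (2 * L * (processLaw ψ π).real (running n)) := by
      rw [ENNReal.ofReal_mul (p := 2 * L) (by linarith), ofReal_measureReal]
    refine le_trans ?_ (add_le_add_left (ofReal_integral_stoppedLogRatio_le ψ ψ' π n) _)
    rw [hr]
    refine (ENNReal.ofReal_le_ofReal ?_).trans ENNReal.ofReal_add_le
    rw [binRelEntropy_eq, ← hL]
    rw [← hL] at hZ
    nlinarith [mul_le_mul_of_nonneg_right hp hL0]
  -- Summability of `P(τ > n)` makes the error term vanish.
  have hlim : Filter.Tendsto (fun n =>
      (∑ b, expectedPulls ψ π b * F.relEntropy (ψ.param b) (ψ'.param b)) +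
        ENNReal.ofReal (2 * L) * processLaw ψ π (running n)) Filter.atTop
      (nhds ((∑ b, expectedPulls ψ π b * F.relEntropy (ψ.param b) (ψ'.param b)) +
        ENNReal.ofReal (2 * L) * 0)) :=
    tendsto_const_nhds.add (ENNReal.Tendsto.const_mul
      (ENNReal.tendsto_atTop_zero_of_tsum_ne_top hτ) (Or.inr ENNReal.ofReal_ne_top))
  rw [mul_zero, add_zero] at hlim
  exact ge_of_tendsto' hlim hbound

/-- The information rate of the sampling proportions `w` under `(i, η₁, η₂)` against the
alternative `(j, η₁', η₂')`. -/
noncomputable def infoRate (F : ExpFamily X d) (w : Fin K → ℝ) (i : Fin K) (η₁ η₂ : F.Θ)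
    (η₁' η₂' : F.Θ) (j : Fin K) : ℝ≥0∞ :=
  ENNReal.ofReal (w i) * F.relEntropy η₁ η₂' + ENNReal.ofReal (w j) * F.relEntropy η₂ η₁' +
    ENNReal.ofReal (1 - w i - w j) * F.relEntropy η₂ η₂'

/-- Arms odd in neither configuration all contribute `D(η₂‖η₂')`, with total weight `1 - w i - w j`.
-/
theorem infoRate_eq_sum {w : Fin K → ℝ} (hw : w ∈ stdSimplex ℝ (Fin K)) (ψ ψ' : Config F K)
    (hne : ψ'.odd ≠ ψ.odd) :
    infoRate F w ψ.odd ψ.η₁ ψ.η₂ ψ'.η₁ ψ'.η₂ ψ'.odd =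
      ∑ b, ENNReal.ofReal (w b) * F.relEntropy (ψ.param b) (ψ'.param b) := by
  classical
  have hmem : ψ'.odd ∈ Finset.univ.erase ψ.odd := by simp [hne]
  have hrest : 1 - w ψ.odd - w ψ'.odd = ∑ b ∈ (Finset.univ.erase ψ.odd).erase ψ'.odd, w b := by
    rw [← hw.2, ← Finset.add_sum_erase _ _ (Finset.mem_univ ψ.odd),
      ← Finset.add_sum_erase _ _ hmem]
    ring
  rw [infoRate, hrest, ENNReal.ofReal_sum_of_nonneg fun b _ => hw.1 b,
    ← Finset.add_sum_erase _ _ (Finset.mem_univ ψ.odd), ← Finset.add_sum_erase _ _ hmem,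
    Finset.sum_mul, add_assoc]
  have h1 : ψ.param ψ.odd = ψ.η₁ := if_pos rfl
  have h2 : ψ'.param ψ.odd = ψ'.η₂ := if_neg hne.symm
  have h3 : ψ.param ψ'.odd = ψ.η₂ := if_neg hne
  have h4 : ψ'.param ψ'.odd = ψ'.η₁ := if_pos rfl
  rw [h1, h2, h3, h4]
  congr 2
  refine Finset.sum_congr rfl fun b hb => ?_
  simp only [Finset.mem_erase, Finset.mem_univ, and_true] at hb
  have h5 : ψ.param b = ψ.η₂ := if_neg hb.2
  have h6 : ψ'.param b = ψ'.η₂ := if_neg hb.1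
  rw [h5, h6]

/-- A lower bound on the information rate against all proper alternatives extends to the
degenerate ones, in which the odd arm has the same parameter as the others. -/
theorem le_infoRate_of_forall_ne {w : Fin K → ℝ} {i j : Fin K} {η₁ η₂ : F.Θ} (hη : η₁ ≠ η₂)
    {c : ℝ≥0∞} (h : ∀ η₁' η₂' : F.Θ, η₁' ≠ η₂' → c ≤ infoRate F w i η₁ η₂ η₁' η₂' j)
    (η₁' η₂' : F.Θ) : c ≤ infoRate F w i η₁ η₂ η₁' η₂' j := by
  by_cases h12 : η₁' = η₂'
  · subst h12
    by_cases h2 : η₂ = η₁'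
    · subst h2
      refine ENNReal.le_of_forall_pos_le_add fun ε hε _ => ?_
      -- With `η₁' = η₂' = η₂`, the odd parameter is perturbed slightly; `η₁ ≠ η₂` supplies a
      -- nonzero direction.
      have hv : (η₁ - η₂ : EuclideanSpace ℝ (Fin d)) ≠ 0 :=
        sub_ne_zero.2 fun h => hη (Subtype.ext h)
      set t : ℝ≥0 := (w j).toNNReal + 1
      have hε' : (0 : ℝ≥0) < ε / t := div_pos hε (by positivity)
      obtain ⟨η', hne, hlt⟩ := F.exists_relEntropy_lt η₂ hv
        (ε := (ε / t : ℝ≥0)) (by exact_mod_cast hε')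
      refine (h η' η₂ hne).trans ?_
      unfold infoRate
      rw [F.relEntropy_self, mul_zero, mul_zero, add_zero, add_zero, add_zero]
      gcongr
      calc ENNReal.ofReal (w j) * F.relEntropy η₂ η'
          ≤ (t : ℝ≥0∞) * (ε / t : ℝ≥0) := by
            gcongr
            exact ENNReal.coe_le_coe.2 le_self_add
        _ = ε := by
            rw [← ENNReal.coe_mul, mul_div_cancel₀ _ (by positivity)]
    -- Replacing the alternative's odd parameter by `η₂` kills the middle term and leaves the others
    -- unchanged, so the rate can only drop.
    · refine (h η₂ η₁' h2).trans ?_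
      unfold infoRate
      rw [F.relEntropy_self, mul_zero]
      gcongr
      exact zero_le
  · exact h η₁' η₂' h12

end LowerBound

end OddArm

/-! ### From expected pulls to sampling proportions -/

/-- Here `‖α‖` is the sup norm on `Fin K → ℝ`, that is, `max_i α_i`. -/
theorem corollary1 {X : Type*} [MeasurableSpace X] {d : ℕ} (F : OddArm.ExpFamily X d)
    {K : ℕ} (hK : 3 ≤ K) (g : Fin K → Fin K → ℝ≥0) (hg : ∀ a, g a a = 0)
    (α : Fin K → ℝ) (hα : ∀ i, 0 < α i ∧ α i < 1) (hα_half : ‖α‖ ≤ 1 / 2)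
    (π : OddArm.Policy K X) (hπ : π ∈ OddArm.admissible F α) (ψ : OddArm.Config F K) :
    ENNReal.ofReal (OddArm.binRelEntropy ‖α‖) / F.complexity ψ.odd ψ.η₁ ψ.η₂ ≤
      OddArm.expectedCost g π ψ := by
  open OddArm in
  have hle : ∀ i, α i ≤ ‖α‖ := fun i => (le_abs_self _).trans (norm_le_pi_norm α i)
  have ha : 0 < ‖α‖ := (hα ψ.odd).1.trans_le (hle _)
  have hadm : ∀ φ : Config F K, processLaw φ π (falseDetection φ.odd) ≤ ENNReal.ofReal ‖α‖ :=
    fun φ => (hπ φ).trans (ENNReal.ofReal_le_ofReal (hle _))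
  have hcost := tsum_running_le_expectedCost g ψ π
  by_cases hτ : ∑' k, processLaw ψ π (running k) = ∞
  · rw [hτ, top_le_iff] at hcost
    rw [hcost]
    exact le_top
  set N := ∑ a, expectedPulls ψ π a with hN
  have hNτ := sum_expectedPulls_le ψ π
  have hNtop : N ≠ ∞ := ne_top_of_le_ne_top hτ hNτ
  refine le_trans ?_ (hNτ.trans hcost)
  have hkey : ∀ ψ' : Config F K, ψ'.odd ≠ ψ.odd → ENNReal.ofReal (binRelEntropy ‖α‖) ≤
      ∑ b, expectedPulls ψ π b * F.relEntropy (ψ.param b) (ψ'.param b) := fun ψ' hne =>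
    binRelEntropy_le_sum_expectedPulls ψ ψ' hne π ha hα_half (hadm ψ) (hadm ψ') hτ
  -- Without pulls there is no information, so comparison with any other odd arm forces `d_b = 0`;
  -- the left side is then `0` even if `D* = 0`.
  by_cases hN0 : N = 0
  · have : Nontrivial (Fin K) := Fin.nontrivial_iff_two_le.2 (by omega)
    obtain ⟨j, hj⟩ := exists_ne ψ.odd
    have hzero : ∀ b, expectedPulls ψ π b = 0 := fun b =>
      Finset.sum_eq_zero_iff.1 hN0 b (Finset.mem_univ b)
    have h0 := hkey ⟨j, ψ.η₁, ψ.η₂, ψ.ne⟩ hj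
    simp only [hzero, zero_mul, Finset.sum_const_zero, nonpos_iff_eq_zero] at h0
    rw [h0, ENNReal.zero_div]
    exact zero_le
  have hfin : ∀ b, expectedPulls ψ π b / N ≠ ∞ := fun b =>
    ENNReal.div_ne_top (ne_top_of_le_ne_top hNtop
      (Finset.single_le_sum (f := expectedPulls ψ π) (fun _ _ => zero_le) (Finset.mem_univ b))) hN0
  set w : Fin K → ℝ := fun b => (expectedPulls ψ π b / N).toReal with hw
  have hwN : ∀ b, ENNReal.ofReal (w b) = expectedPulls ψ π b / N := fun b =>
    ENNReal.ofReal_toReal (hfin b)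
  have hws : w ∈ stdSimplex ℝ (Fin K) := by
    refine ⟨fun b => ENNReal.toReal_nonneg, ?_⟩
    simp only [hw]
    rw [← ENNReal.toReal_sum fun b _ => hfin b]
    simp_rw [div_eq_mul_inv]
    rw [← Finset.sum_mul, ← hN, ENNReal.mul_inv_cancel hN0 hNtop, ENNReal.toReal_one]
  -- The product form covers `D* = 0` and `D* = ∞` as well.
  refine ENNReal.div_le_of_le_mul ?_
  rw [mul_comm, ← ENNReal.div_le_iff hN0 hNtop]
  refine le_trans ?_ (le_iSup₂_of_le w hws le_rfl)
  refine le_iInf fun η₁' => le_iInf fun η₂' => le_iInf₂ fun j hj => ?_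
  refine le_infoRate_of_forall_ne ψ.ne (fun η₁' η₂' hne => ?_) η₁' η₂'
  rw [infoRate_eq_sum hws ψ ⟨j, η₁', η₂', hne⟩ hj, ENNReal.div_le_iff hN0 hNtop, Finset.sum_mul]
  refine (hkey ⟨j, η₁', η₂', hne⟩ hj).trans (Finset.sum_le_sum fun b _ => ?_)
  rw [hwN, mul_right_comm, ENNReal.div_mul_cancel hN0 hNtop]
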